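/- Let $A_1,A_2\subset\mathbb R^2$ be compact sets (primitives) of unit area, and let $B_1,B_2\subset\mathbb R^2$ be nonempty, convex, compact sets (structuring elements). For a compact set $I\subset\mathbb R^2$ and a structuring element $B$, let $I\circ tB=\bigcup\{tB+y : tB+y\subset I\}$ for $t>0$ and $I\circ 0B=I$. Let $\Omega_I(t)$ be the area of $I\circ tB$, and put $\Phi_I(t)=1-\Omega_I(t)/\Omega_I(0)$ for $t\ge 0$ and $\Phi_I(t)=0$ for $t<0$ (if $I$ has area zero, all moments below are understood to be $0$). The granulometric moments of $I$ are $\mu^{(k)}(I,B)=\int t^k\,d\Phi_I(t)$. Put $$M=\begin{bmatrix}M_1&0\\0&M_2\end{bmatrix},\qquad M_k=\begin{bmatrix}\mu^{(k)}(A_1,B_1)&\mu^{(k)}(A_2,B_1)\\ \mu^{(k)}(A_1,B_2)&\mu^{(k)}(A_2,B_2)\end{bmatrix},$$ and assume that $M$ is invertible. For a sequence of values of $N$ tending to infinity, let $$I=\bigcup_{i=1}^{2}\bigcup_{j=1}^{N_i}(r_{ij}A_i+x_{ij}),\qquad N=N_1+N_2,$$ be a random image whose $N$ grains $r_{ij}A_i+x_{ij}$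 are almost surely pairwise disjoint. The proportions $b_i=N_i/N$ are fixed (the same for all $N$ in the sequence). The radii $r_{ij}\ge 0$ are independent, and $r_{ij}$ has a law (the grain sizing distribution of primitive $i$) that depends neither on $j$ nor on $N$, with finite moments $E[r_{ij}^k]=\gamma_{ik}\beta^k$ for $k=2,3,\dots,8$, where $\beta>0$. Assume $D:=b_1\gamma_{12}+b_2\gamma_{22}>0$. The centers $x_{ij}$ are otherwise arbitrary. Let $$\mathbf z=[\mu^{(1)}(I,B_1),\ \mu^{(1)}(I,B_2),\ \mu^{(2)}(I,B_1),\ \mu^{(2)}(I,B_2)]^T,\qquad \mathbf x=M^{-1}\mathbf z .$$ Then almost surely $\mathbf x=[x_{11},x_{21},x_{12},x_{22}]^T$ with $$x_{ik}=\frac{\sum_{j=1}^{N_i}r_{ij}^{k+2}}{\sum_{j=1}^{N_1}r_{1j}^2+\sum_{j=1}^{N_2}r_{2j}^2}$$ (read as $0$ if the denominator vanishes). As $N\to\infty$, $\mathbf x$ is asymptotically jointly normal with mean $\mathbf m$ and covariance $\frac1N\Sigma$; that is, $\Sigma$ is positive semidefinite and $\sqrt N(\mathbf x-\mathbf m)$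 converges in distribution to $\mathcal N(\mathbf 0,\Sigma)$ (which may be degenerate), where $$\mathbf m=\frac1D\,[\,b_1\gamma_{13}\beta,\ b_2\gamma_{23}\beta,\ b_1\gamma_{14}\beta^2,\ b_2\gamma_{24}\beta^2\,]^T,\qquad \Sigma=\frac1{D^4}\begin{bmatrix}A_{11}\beta^2&A_{12}\beta^3\\A_{21}\beta^3&A_{22}\beta^4\end{bmatrix},$$ and, for $i,j\in\{1,2\}$, the $2\times 2$ matrices $A_{ij}$ (not to be confused with the primitives) are $$A_{ij}=\begin{bmatrix}b_1^2(b_1B_{ij1}^{11}+b_2B_{ij1}^{12})&b_1b_2(b_1B_{ij1}^{21}+b_2B_{ij1}^{22})\\ b_1b_2(b_1B_{ij2}^{11}+b_2B_{ij2}^{12})&b_2^2(b_1B_{ij2}^{21}+b_2B_{ij2}^{22})\end{bmatrix}+\begin{bmatrix}b_1D^2C_{ij1}&0\\0&b_2D^2C_{ij2}\end{bmatrix},$$ $$B_{ijk}^{lp}=C_{00p}\gamma_{k(i+2)}\gamma_{l(j+2)}-\gamma_{p2}\gamma_{k(i+2)}C_{0jl}-\gamma_{p2}C_{i0k}\gamma_{l(j+2)},\qquad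 C_{ijk}=\gamma_{k(i+j+4)}-\gamma_{k(i+2)}\gamma_{k(j+2)}.$$ -/

import Mathlib

open MeasureTheory ProbabilityTheory Filter Topology
open scoped Pointwise Matrix

/-- The Euclidean plane, in which the binary images live. -/
abbrev Plane : Type := EuclideanSpace ℝ (Fin 2)

/-- The granulometry generated by the structuring element `B`: for `t > 0` the morphological
opening `I ∘ tB`, that is the union of all translates of `tB` contained in `I`; the image `I`
itself for `t = 0` (and, by convention, for `t < 0`). -/
def opening (I B : Set Plane) (t : ℝ) : Set Plane :=
  if 0 < t then ⋃ y ∈ {y : Plane | y +ᵥ t • B ⊆ I}, (y +ᵥ t • B) else I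

/-- The size distribution: the area of the opening of `I` by `tB`. -/
noncomputable def sizeDistribution (I B : Set Plane) (t : ℝ) : ℝ :=
  (volume (opening I B t)).toReal

/-- The normalized size distribution (pattern spectrum) of `I` relative to `B`. It vanishes on
`(-∞, 0]` when `I` has positive finite area. -/
noncomputable def patternSpectrum (I B : Set Plane) (t : ℝ) : ℝ :=
  1 - sizeDistribution I B t / sizeDistribution I B 0

theorem opening_subset (I B : Set Plane) (t : ℝ) : opening I B t ⊆ I := by
  unfold opening
  split_ifs
  · exact Set.iUnion₂_subset fun y hy => hy
  · exact subset_rfl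

theorem opening_antitone (I : Set Plane) (B : ConvexBody Plane) :
    Antitone (opening I (B : Set Plane)) := by
  intro s t hst
  by_cases hs : 0 < s
  · have ht : 0 < t := hs.trans_le hst
    intro x hx
    simp only [opening, if_pos ht, if_pos hs, Set.mem_iUnion, Set.mem_ofPred_eq] at hx ⊢
    obtain ⟨y, hy, hxy⟩ := hx
    obtain ⟨_, ⟨b, hb, rfl⟩, rfl⟩ := hxy
    refine ⟨y + (t - s) • b, ?_, ?_⟩
    · rintro _ ⟨_, ⟨c, hc, rfl⟩, rfl⟩
      apply hy
      refine ⟨t • (((t - s) / t) • b + (s / t) • c), ⟨_, ?_, rfl⟩, ?_⟩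
      · exact B.convex hb hc (div_nonneg (sub_nonneg.2 hst) ht.le) (div_nonneg hs.le ht.le)
          (by field_simp; ring)
      · simp only [vadd_eq_add, smul_add, smul_smul, mul_div_cancel₀ _ ht.ne', add_assoc]
    · refine ⟨s • b, ⟨b, hb, rfl⟩, ?_⟩
      simp only [vadd_eq_add, sub_smul]
      abel
  · have h : opening I (B : Set Plane) s = I := if_neg hs
    rw [h]
    exact opening_subset I B t

/-- For a compact image and a convex compact structuring element the pattern spectrum is
monotone, so that it defines a Lebesgue-Stieltjes measure. -/
theorem patternSpectrum_monotone {I : Set Plane} (hI : IsCompact I) (B : ConvexBody Plane) :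
    Monotone (patternSpectrum I (B : Set Plane)) := by
  intro s t hst
  have hfin : volume (opening I (B : Set Plane) s) ≠ ⊤ :=
    ((measure_mono (opening_subset I B s)).trans_lt hI.measure_lt_top).ne
  have h : sizeDistribution I (B : Set Plane) t ≤ sizeDistribution I (B : Set Plane) s :=
    ENNReal.toReal_mono hfin (measure_mono (opening_antitone I B hst))
  exact sub_le_sub_left (div_le_div_of_nonneg_right h ENNReal.toReal_nonneg) 1

open Classical in
/-- The Lebesgue-Stieltjes measure `dΦ` of the pattern spectrum `Φ` of `I` relative to `B` (the
right-continuous version of `Φ` defines the same measure as `Φ`, which is continuous from the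
left). The condition holds for every compact `I`, see `patternSpectrum_monotone`. -/
noncomputable def patternMeasure (I : Set Plane) (B : ConvexBody Plane) : Measure ℝ :=
  if h : Monotone (patternSpectrum I (B : Set Plane)) then h.stieltjesFunction.measure else 0

/-- The `k`-th granulometric moment `μ⁽ᵏ⁾(I, B) = ∫ tᵏ dΦ(t)`. -/
noncomputable def granulometricMoment (k : ℕ) (I : Set Plane) (B : ConvexBody Plane) : ℝ :=
  ∫ t, t ^ k ∂(patternMeasure I B)

/-- The `j`-th grain of type `i`: the primitive `A i` scaled by the radius and translated to the
center. -/
def grain {n : Fin 2 → ℕ} (A : Fin 2 → Set Plane) (r : (Σ i, Fin (n i)) → ℝ)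
    (c : (Σ i, Fin (n i)) → Plane) (p : Σ i, Fin (n i)) : Set Plane :=
  c p +ᵥ r p • A p.1

/-- The image: the union of all grains, `n i` of them being of type `i`. -/
def grainImage {n : Fin 2 → ℕ} (A : Fin 2 → Set Plane) (r : (Σ i, Fin (n i)) → ℝ)
    (c : (Σ i, Fin (n i)) → Plane) : Set Plane :=
  ⋃ p, grain A r c p

/-- The vector `z = [μ⁽¹⁾(I,B₁), μ⁽¹⁾(I,B₂), μ⁽²⁾(I,B₁), μ⁽²⁾(I,B₂)]ᵀ` of granulometric moments;
the left summand of the index type holds the first moments, the right one the second moments. -/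
noncomputable def momentVector (B : Fin 2 → ConvexBody Plane) (I : Set Plane) :
    Fin 2 ⊕ Fin 2 → ℝ :=
  Sum.elim (fun j => granulometricMoment 1 I (B j)) (fun j => granulometricMoment 2 I (B j))

/-- The block diagonal matrix `M` of the granulometric moments of the primitives. -/
noncomputable def primitiveMatrix (A : Fin 2 → Set Plane) (B : Fin 2 → ConvexBody Plane) :
    Matrix (Fin 2 ⊕ Fin 2) (Fin 2 ⊕ Fin 2) ℝ :=
  Matrix.fromBlocks
    !![granulometricMoment 1 (A 0) (B 0), granulometricMoment 1 (A 1) (B 0);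
       granulometricMoment 1 (A 0) (B 1), granulometricMoment 1 (A 1) (B 1)]
    0 0
    !![granulometricMoment 2 (A 0) (B 0), granulometricMoment 2 (A 1) (B 0);
       granulometricMoment 2 (A 0) (B 1), granulometricMoment 2 (A 1) (B 1)]

/-- The feature vector `x = M⁻¹ z` of the image `I`. -/
noncomputable def featureVector (A : Fin 2 → Set Plane) (B : Fin 2 → ConvexBody Plane)
    (I : Set Plane) : Fin 2 ⊕ Fin 2 → ℝ :=
  (primitiveMatrix A B)⁻¹ *ᵥ momentVector B I

/-- The quotient `x_{ik} = ∑ⱼ r_{ij}^{k+2} / ∑ₚ r_p²`, the last sum being over all grains. -/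
noncomputable def radiiRatio {n : Fin 2 → ℕ} (r : (Σ i, Fin (n i)) → ℝ) (i : Fin 2) (k : ℕ) : ℝ :=
  (∑ j : Fin (n i), r ⟨i, j⟩ ^ (k + 2)) / ∑ p, r p ^ 2

/-- `b₁ γ₁₂ + b₂ γ₂₂`. -/
def meanSquare (b : Fin 2 → ℝ) (γ : Fin 2 → ℕ → ℝ) : ℝ :=
  b 0 * γ 0 2 + b 1 * γ 1 2

/-- The asymptotic mean vector. -/
noncomputable def asympMean (b : Fin 2 → ℝ) (γ : Fin 2 → ℕ → ℝ) (β : ℝ) : Fin 2 ⊕ Fin 2 → ℝ :=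
  (1 / meanSquare b γ) •
    Sum.elim ![b 0 * γ 0 3 * β, b 1 * γ 1 3 * β] ![b 0 * γ 0 4 * β ^ 2, b 1 * γ 1 4 * β ^ 2]

/-- `C_{ijk}`. -/
def constC (γ : Fin 2 → ℕ → ℝ) (i j : ℕ) (k : Fin 2) : ℝ :=
  γ k (i + j + 4) - γ k (i + 2) * γ k (j + 2)

/-- `B_{ijk}^{lp}`. -/
def constB (γ : Fin 2 → ℕ → ℝ) (i j : ℕ) (k l p : Fin 2) : ℝ :=
  constC γ 0 0 p * γ k (i + 2) * γ l (j + 2)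
    - γ p 2 * γ k (i + 2) * constC γ 0 j l - γ p 2 * constC γ i 0 k * γ l (j + 2)

/-- The `2 × 2` matrix `A_{ij}`. -/
def blockA (b : Fin 2 → ℝ) (γ : Fin 2 → ℕ → ℝ) (i j : ℕ) : Matrix (Fin 2) (Fin 2) ℝ :=
  !![b 0 ^ 2 * (b 0 * constB γ i j 0 0 0 + b 1 * constB γ i j 0 0 1),
     b 0 * b 1 * (b 0 * constB γ i j 0 1 0 + b 1 * constB γ i j 0 1 1);
     b 0 * b 1 * (b 0 * constB γ i j 1 0 0 + b 1 * constB γ i j 1 0 1),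
     b 1 ^ 2 * (b 0 * constB γ i j 1 1 0 + b 1 * constB γ i j 1 1 1)]
  + !![b 0 * meanSquare b γ ^ 2 * constC γ i j 0, 0;
       0, b 1 * meanSquare b γ ^ 2 * constC γ i j 1]

/-- `N` times the asymptotic covariance matrix. -/
noncomputable def asympCov (b : Fin 2 → ℝ) (γ : Fin 2 → ℕ → ℝ) (β : ℝ) :
    Matrix (Fin 2 ⊕ Fin 2) (Fin 2 ⊕ Fin 2) ℝ :=
  (1 / meanSquare b γ ^ 4) •
    Matrix.fromBlocks (β ^ 2 • blockA b γ 1 1) (β ^ 3 • blockA b γ 1 2)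
      (β ^ 3 • blockA b γ 2 1) (β ^ 4 • blockA b γ 2 2)

/-! ### Openings of disjoint unions and of scaled sets -/

/-! A translate of `tB` is convex, hence connected, so inside a disjoint union of compact grains it
lies in a single grain. The opening therefore splits over the grains, and a grain of radius `r`
contributes the area `r² Ω_A(t/r)`. Hence `dΦ_I` is a mixture of dilated pattern measures of the
primitives with weights `r_p² / ∑ r_q²`. Integrating `t^k` produces `r_p^(k+2) / ∑ r_q²`, that is `z
= M x` with `x` the radii ratios (`momentVector_grainImage`).

The limit law is a delta method that is exact for ratios: `√N (x - m)` equals `(∑ r² / N)⁻¹` times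
`N^(-1/2)` times a sum of independent grain contributions (`scaledRatio_eq`). Paired with a vector
`t`, that sum has mean zero by the choice of `m`, and its variance divided by `N` is `(Dβ²)² tᵀΣt`
(`sum_integral_influence`, `dotProduct_asympCov_mulVec`). Characteristic functions give the Gaussian
limit of the linear part, the strong law gives `∑ r² / N → Dβ²`, and Slutsky's theorem combines the
two. The same variance identity shows that `Σ` is positive semidefinite. -/

theorem opening_of_pos (I B : Set Plane) {t : ℝ} (ht : 0 < t) :
    opening I B t = ⋃ y ∈ {y : Plane | y +ᵥ t • B ⊆ I}, (y +ᵥ t • B) := if_pos ht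

theorem opening_of_nonpos (I B : Set Plane) {t : ℝ} (ht : t ≤ 0) : opening I B t = I :=
  if_neg ht.not_gt

theorem mem_opening_of_pos {I B : Set Plane} {t : ℝ} (ht : 0 < t) {x : Plane} :
    x ∈ opening I B t ↔ ∃ y : Plane, y +ᵥ t • B ⊆ I ∧ x ∈ y +ᵥ t • B := by
  simp [opening_of_pos I B ht]

/-- A preconnected set covered by finitely many disjoint closed sets lies in one of them. -/
theorem IsPreconnected.exists_subset_of_subset_iUnion {X ι : Type*} [TopologicalSpace X]
    [Finite ι] {s : Set X} (hs : IsPreconnected s) (hne : s.Nonempty) {K : ι → Set X}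
    (hK : ∀ i, IsClosed (K i)) (hd : Pairwise fun i j => Disjoint (K i) (K j))
    (h : s ⊆ ⋃ i, K i) : ∃ i, s ⊆ K i := by
  obtain ⟨x, hx⟩ := hne
  obtain ⟨i, hi⟩ := Set.mem_iUnion.1 (h hx)
  refine ⟨i, ?_⟩
  set V : Set X := ⋃ j : {j // j ≠ i}, K j with hV
  have hVc : IsClosed V := isClosed_iUnion_of_finite fun j => hK j
  have hdis : Disjoint (K i) V := Set.disjoint_iUnion_right.2 fun j => hd j.2.symm
  have hsub : s ⊆ K i ∪ V := by
    intro y hy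
    obtain ⟨j, hj⟩ := Set.mem_iUnion.1 (h hy)
    by_cases hji : j = i
    · exact Or.inl (hji ▸ hj)
    · exact Or.inr (Set.mem_iUnion.2 ⟨⟨j, hji⟩, hj⟩)
  rcases isPreconnected_iff_subset_of_disjoint_closed.1 hs _ _ (hK i) hVc hsub
    (by rw [hdis.inter_eq, Set.inter_empty]) with h' | h'
  · exact h'
  · exact absurd (h' hx) (Set.disjoint_left.1 hdis hi)

theorem opening_iUnion {ι : Type*} [Finite ι] {K : ι → Set Plane} (hK : ∀ i, IsCompact (K i))
    (hd : Pairwise fun i j => Disjoint (K i) (K j)) (B : ConvexBody Plane) (t : ℝ) :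
    opening (⋃ i, K i) (B : Set Plane) t = ⋃ i, opening (K i) (B : Set Plane) t := by
  rcases le_or_gt t 0 with ht | ht
  · simp [opening_of_nonpos _ _ ht]
  ext x
  simp only [Set.mem_iUnion, mem_opening_of_pos ht]
  constructor
  · rintro ⟨y, hy, hx⟩
    have hpre : IsPreconnected (y +ᵥ t • (B : Set Plane)) :=
      ((B.convex.smul t).vadd y).isPreconnected
    obtain ⟨i, hi⟩ := hpre.exists_subset_of_subset_iUnion ⟨x, hx⟩ (fun i => (hK i).isClosed) hd hy
    exact ⟨i, y, hi, hx⟩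
  · rintro ⟨i, y, hy, hx⟩
    exact ⟨y, hy.trans (Set.subset_iUnion K i), hx⟩

/-- The bijection `z ↦ c + r z` carries the translates of `(t/r)B` onto those of `tB` and preserves
inclusions. -/
theorem opening_vadd_smul (A B : Set Plane) (c : Plane) {r : ℝ} (hr : 0 < r) (t : ℝ) :
    opening (c +ᵥ r • A) B t = c +ᵥ r • opening A B (t / r) := by
  rcases le_or_gt t 0 with ht | ht
  · rw [opening_of_nonpos _ _ ht, opening_of_nonpos _ _ (div_nonpos_of_nonpos_of_nonneg ht hr.le)]
  have key : ∀ y : Plane, (c + r • y) +ᵥ t • B = c +ᵥ r • (y +ᵥ (t / r) • B) := by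
    intro y
    rw [← Set.image_vadd, ← Set.image_vadd, ← Set.image_vadd, ← Set.image_smul, ← Set.image_smul,
      ← Set.image_smul]
    simp only [Set.image_image, vadd_eq_add, smul_add, smul_smul, mul_div_cancel₀ _ hr.ne',
      add_assoc]
  ext x
  have hmem : ∀ S : Set Plane, x ∈ c +ᵥ r • S ↔ r⁻¹ • (x - c) ∈ S := by
    intro S
    rw [Set.mem_vadd_set_iff_neg_vadd_mem, Set.mem_smul_set_iff_inv_smul_mem₀ hr.ne', vadd_eq_add,
      neg_add_eq_sub]
  rw [hmem, mem_opening_of_pos ht, mem_opening_of_pos (div_pos ht hr)]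
  constructor
  · rintro ⟨y, hy, hx⟩
    obtain ⟨z, rfl⟩ : ∃ z, y = c + r • z := ⟨r⁻¹ • (y - c), by simp [hr.ne']⟩
    rw [key] at hy hx
    refine ⟨z, ?_, (hmem _).1 hx⟩
    rwa [Set.vadd_set_subset_vadd_set_iff, Set.smul_set_subset_smul_set_iff₀ hr.ne'] at hy
  · rintro ⟨z, hz, hx⟩
    refine ⟨c + r • z, ?_, ?_⟩
    · rw [key]
      rwa [Set.vadd_set_subset_vadd_set_iff, Set.smul_set_subset_smul_set_iff₀ hr.ne']
    · rw [key]
      exact (hmem _).2 hx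

/-! ### Size distributions -/

/-- Additivity of a measure on (possibly non-measurable) subsets of disjoint measurable sets. -/
theorem MeasureTheory.measure_iUnion_of_subset {α ι : Type*} [MeasurableSpace α] [Countable ι]
    (μ : Measure α) {K S : ι → Set α} (hK : ∀ i, MeasurableSet (K i))
    (hd : Pairwise fun i j => Disjoint (K i) (K j)) (hS : ∀ i, S i ⊆ K i) :
    μ (⋃ i, S i) = ∑' i, μ (S i) := by
  set T := ⋃ i, S i with hT
  -- Restricting to `T` moves additivity to the measurable sets `K i`: the restricted measure of `K
  -- i` is `μ (K i ∩ T) = μ (S i)`.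
  have h := measure_iUnion (μ := μ.restrict T) (f := K) hd hK
  rw [Measure.restrict_apply (MeasurableSet.iUnion hK)] at h
  have h1 : (⋃ i, K i) ∩ T = T :=
    Set.inter_eq_right.2 (Set.iUnion_mono hS)
  have h2 : ∀ i, K i ∩ T = S i := by
    intro i
    apply Set.Subset.antisymm
    · rintro x ⟨hx, hxT⟩
      obtain ⟨j, hj⟩ := Set.mem_iUnion.1 hxT
      by_cases hij : i = j
      · exact hij ▸ hj
      · exact absurd (hS j hj) (Set.disjoint_left.1 (hd hij) hx)
    · exact fun x hx => ⟨hS i hx, Set.mem_iUnion.2 ⟨i, hx⟩⟩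
  rw [h1] at h
  rw [h]
  exact tsum_congr fun i => by rw [Measure.restrict_apply (hK i), h2]

theorem volume_opening_ne_top {I : Set Plane} (hI : IsCompact I) (B : Set Plane) (t : ℝ) :
    volume (opening I B t) ≠ ⊤ :=
  ((measure_mono (opening_subset I B t)).trans_lt hI.measure_lt_top).ne

theorem sizeDistribution_iUnion {ι : Type*} [Fintype ι] {K : ι → Set Plane}
    (hK : ∀ i, IsCompact (K i)) (hd : Pairwise fun i j => Disjoint (K i) (K j))
    (B : ConvexBody Plane) (t : ℝ) :
    sizeDistribution (⋃ i, K i) B t = ∑ i, sizeDistribution (K i) B t := by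
  unfold sizeDistribution
  rw [opening_iUnion hK hd, measure_iUnion_of_subset volume (fun i => (hK i).measurableSet) hd
    (fun i => opening_subset _ _ _), tsum_fintype,
    ENNReal.toReal_sum fun i _ => volume_opening_ne_top (hK i) _ _]

theorem sizeDistribution_vadd_smul (A B : Set Plane) (c : Plane) {r : ℝ} (hr : 0 ≤ r) (t : ℝ) :
    sizeDistribution (c +ᵥ r • A) B t = r ^ 2 * sizeDistribution A B (t / r) := by
  rcases hr.eq_or_lt with rfl | hr
  -- A grain of radius zero is a null set, and the factor `r ^ 2` kills the meaningless `t / 0`.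
  · have : volume (opening (c +ᵥ (0 : ℝ) • A) B t) = 0 := by
      refine measure_mono_null (opening_subset _ _ _) ?_
      rw [measure_vadd, Measure.addHaar_smul]
      simp
    simp [sizeDistribution, this]
  · simp [sizeDistribution, opening_vadd_smul _ _ _ hr, measure_vadd, Measure.addHaar_smul,
      ENNReal.toReal_mul, sq_nonneg]

theorem IsCompact.grain {n : Fin 2 → ℕ} {A : Fin 2 → Set Plane} (hA : ∀ i, IsCompact (A i))
    (r : (Σ i, Fin (n i)) → ℝ) (c : (Σ i, Fin (n i)) → Plane) (p : Σ i, Fin (n i)) :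
    IsCompact (grain A r c p) :=
  ((hA p.1).smul (r p)).vadd (c p)

theorem IsCompact.grainImage {n : Fin 2 → ℕ} {A : Fin 2 → Set Plane} (hA : ∀ i, IsCompact (A i))
    (r : (Σ i, Fin (n i)) → ℝ) (c : (Σ i, Fin (n i)) → Plane) :
    IsCompact (grainImage A r c) :=
  isCompact_iUnion fun p => IsCompact.grain hA r c p

/-! ### The image as a mixture of rescaled primitives -/

section Image

variable {n : Fin 2 → ℕ} {A : Fin 2 → Set Plane} {r : (Σ i, Fin (n i)) → ℝ}
  {c : (Σ i, Fin (n i)) → Plane}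

theorem sizeDistribution_grainImage (hA : ∀ i, IsCompact (A i)) (hr : ∀ p, 0 ≤ r p)
    (hd : Pairwise fun p q => Disjoint (grain A r c p) (grain A r c q))
    (B : ConvexBody Plane) (t : ℝ) :
    sizeDistribution (grainImage A r c) B t
      = ∑ p, r p ^ 2 * sizeDistribution (A p.1) B (t / r p) := by
  unfold grainImage
  rw [sizeDistribution_iUnion (fun p => IsCompact.grain hA r c p) hd]
  exact Finset.sum_congr rfl fun p _ => sizeDistribution_vadd_smul _ _ _ (hr p) _

theorem sizeDistribution_zero (I B : Set Plane) : sizeDistribution I B 0 = (volume I).toReal := by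
  rw [sizeDistribution, opening_of_nonpos _ _ le_rfl]

/-- The additive constant is `0` unless all radii vanish; then all weights are `0 / 0 = 0` and it is
`1`. It keeps the identity free of a case distinction, and a constant does not affect the Stieltjes
measure. -/
theorem patternSpectrum_grainImage (hA : ∀ i, IsCompact (A i)) (hA1 : ∀ i, volume (A i) = 1)
    (hr : ∀ p, 0 ≤ r p) (hd : Pairwise fun p q => Disjoint (grain A r c p) (grain A r c q))
    (B : ConvexBody Plane) (t : ℝ) :
    patternSpectrum (grainImage A r c) B t
      = (1 - ∑ p, r p ^ 2 / ∑ q, r q ^ 2)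
        + ∑ p, r p ^ 2 / (∑ q, r q ^ 2) * patternSpectrum (A p.1) B (t / r p) := by
  simp only [patternSpectrum, sizeDistribution_grainImage hA hr hd, sizeDistribution_zero, hA1,
    zero_div, ENNReal.toReal_one, mul_one, div_one, mul_sub, Finset.sum_sub_distrib,
    Finset.sum_div]
  rw [sub_add_sub_cancel]
  congr 1
  exact Finset.sum_congr rfl fun p _ => by ring

/-! ### Pattern measures -/

theorem patternMeasure_eq {I : Set Plane} (hI : IsCompact I) (B : ConvexBody Plane) :
    patternMeasure I B = (patternSpectrum_monotone hI B).stieltjesFunction.measure :=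
  dif_pos _

theorem patternMeasure_Ioc {I : Set Plane} (hI : IsCompact I) (B : ConvexBody Plane) (s t : ℝ) :
    patternMeasure I B (Set.Ioc s t) = ENNReal.ofReal
      (Function.rightLim (patternSpectrum I B) t - Function.rightLim (patternSpectrum I B) s) := by
  rw [patternMeasure_eq hI, StieltjesFunction.measure_Ioc, Monotone.stieltjesFunction_eq,
    Monotone.stieltjesFunction_eq]

instance (I : Set Plane) (B : ConvexBody Plane) : IsLocallyFiniteMeasure (patternMeasure I B) := by
  unfold patternMeasure
  split_ifs <;> infer_instance

theorem rightLim_patternSpectrum_grainImage (hA : ∀ i, IsCompact (A i))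
    (hA1 : ∀ i, volume (A i) = 1)
    (hr : ∀ p, 0 ≤ r p) (hd : Pairwise fun p q => Disjoint (grain A r c p) (grain A r c q))
    (B : ConvexBody Plane) (t : ℝ) :
    Function.rightLim (patternSpectrum (grainImage A r c) B) t
      = (1 - ∑ p, r p ^ 2 / ∑ q, r q ^ 2)
        + ∑ p, r p ^ 2 / (∑ q, r q ^ 2) *
          Function.rightLim (patternSpectrum (A p.1) B) (t / r p) := by
  apply rightLim_eq_of_tendsto
  have : patternSpectrum (grainImage A r c) B = _ :=
    funext (patternSpectrum_grainImage hA hA1 hr hd B)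
  rw [this]
  refine tendsto_const_nhds.add (tendsto_finsetSum _ fun p _ => ?_)
  rcases (hr p).eq_or_lt with hp | hp
  · simp [← hp]
  -- Division by a positive radius maps points to the right of `t` to points to the right of `t / r
  -- p`, so right limits are preserved.
  · refine Tendsto.const_mul _ ?_
    refine ((patternSpectrum_monotone (hA p.1) B).tendsto_rightLim (t / r p)).comp ?_
    refine tendsto_nhdsWithin_of_tendsto_nhds_of_eventually_within _ ?_ ?_
    · exact ((continuous_id.div_const _).tendsto t).mono_left nhdsWithin_le_nhds
    · filter_upwards [self_mem_nhdsWithin] with s hs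
      exact div_lt_div_of_pos_right hs hp

/-- It suffices to compare half-open intervals, where both sides are increments of right limits and
the additive constant cancels. -/
theorem patternMeasure_grainImage (hA : ∀ i, IsCompact (A i)) (hA1 : ∀ i, volume (A i) = 1)
    (hr : ∀ p, 0 ≤ r p) (hd : Pairwise fun p q => Disjoint (grain A r c p) (grain A r c q))
    (B : ConvexBody Plane) :
    patternMeasure (grainImage A r c) B
      = ∑ p, ENNReal.ofReal (r p ^ 2 / ∑ q, r q ^ 2) •
        (patternMeasure (A p.1) B).map (· * r p) := by
  apply Measure.ext_of_Ioc
  intro s t hst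
  have hw : ∀ p, 0 ≤ r p ^ 2 / ∑ q, r q ^ 2 := fun p =>
    div_nonneg (sq_nonneg _) (Finset.sum_nonneg fun q _ => sq_nonneg _)
  have hmono : ∀ p, Function.rightLim (patternSpectrum (A p.1) B) (s / r p)
      ≤ Function.rightLim (patternSpectrum (A p.1) B) (t / r p) := fun p =>
    (patternSpectrum_monotone (hA p.1) B).rightLim (div_le_div_of_nonneg_right hst.le (hr p))
  rw [patternMeasure_Ioc (IsCompact.grainImage hA r c),
    rightLim_patternSpectrum_grainImage hA hA1 hr hd,
    rightLim_patternSpectrum_grainImage hA hA1 hr hd, add_sub_add_left_eq_sub,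
    ← Finset.sum_sub_distrib, Measure.finsetSum_apply,
    ENNReal.ofReal_sum_of_nonneg fun p _ => by
      rw [← mul_sub]; exact mul_nonneg (hw p) (sub_nonneg.2 (hmono p))]
  refine Finset.sum_congr rfl fun p _ => ?_
  rw [Measure.smul_apply, smul_eq_mul, ← mul_sub, ENNReal.ofReal_mul (hw p)]
  rcases (hr p).eq_or_lt with hp | hp
  · simp [← hp]
  · rw [Measure.map_apply (by fun_prop) measurableSet_Ioc]
    have : (fun x => x * r p) ⁻¹' Set.Ioc s t = Set.Ioc (s / r p) (t / r p) := by
      ext x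
      simp [div_lt_iff₀ hp, le_div_iff₀ hp]
    rw [this, patternMeasure_Ioc (hA p.1)]

/-! ### Granulometric moments -/

theorem patternSpectrum_of_nonpos (I B : Set Plane) {t : ℝ} (ht : t ≤ 0) :
    patternSpectrum I B t = patternSpectrum I B 0 := by
  rw [patternSpectrum, patternSpectrum, sizeDistribution, opening_of_nonpos _ _ ht,
    sizeDistribution_zero]

/-- If `B` is a point, opening changes nothing. Otherwise `tB` contains two points at distance `t *
dist u v`, which eventually exceeds the diameter of `I`, and the opening becomes empty. -/
theorem exists_opening_eq {I : Set Plane} (hI : IsCompact I) (B : ConvexBody Plane) :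
    ∃ T : ℝ, 0 < T ∧ ∀ t, T ≤ t → opening I B t = opening I B T := by
  by_cases hB : (B : Set Plane).Subsingleton
  · obtain ⟨u, hu⟩ := B.nonempty
    have hBu : (B : Set Plane) = {u} := hB.eq_singleton_of_mem hu
    have h : ∀ t : ℝ, 0 < t → opening I B t = I := by
      intro t ht
      ext x
      rw [mem_opening_of_pos ht, hBu]
      simp only [Set.smul_set_singleton, Set.vadd_set_singleton, Set.singleton_subset_iff,
        Set.mem_singleton_iff, vadd_eq_add]
      constructor
      · rintro ⟨y, hy, rfl⟩
        exact hy
      · exact fun hx => ⟨x - t • u, by simpa using hx, by simp⟩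
    exact ⟨1, one_pos, fun t ht => by rw [h t (one_pos.trans_le ht), h 1 one_pos]⟩
  · obtain ⟨u, hu, v, hv, huv⟩ := Set.not_subsingleton_iff.1 hB
    have hd : 0 < dist u v := dist_pos.2 huv
    have h : ∀ t : ℝ, Metric.diam I / dist u v + 1 ≤ t → opening I B t = ∅ := by
      intro t ht
      have ht0 : 0 < t := (add_pos_of_nonneg_of_pos (div_nonneg Metric.diam_nonneg hd.le)
        one_pos).trans_le ht
      rw [Set.eq_empty_iff_forall_notMem]
      intro x hx
      obtain ⟨y, hy, -⟩ := (mem_opening_of_pos ht0).1 hx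
      have hu' : y +ᵥ t • u ∈ I := hy (Set.vadd_mem_vadd_set (Set.smul_mem_smul_set hu))
      have hv' : y +ᵥ t • v ∈ I := hy (Set.vadd_mem_vadd_set (Set.smul_mem_smul_set hv))
      have h1 := Metric.dist_le_diam_of_mem hI.isBounded hu' hv'
      rw [vadd_eq_add, vadd_eq_add, dist_add_left, dist_smul₀, Real.norm_of_nonneg ht0.le,
        ← le_div_iff₀ hd] at h1
      linarith
    refine ⟨Metric.diam I / dist u v + 1, add_pos_of_nonneg_of_pos
      (div_nonneg Metric.diam_nonneg hd.le) one_pos, fun t ht => by rw [h t ht, h _ le_rfl]⟩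

theorem rightLim_eq_of_forall_ge {f : ℝ → ℝ} {T y : ℝ} (h : ∀ t, T ≤ t → f t = y) {t : ℝ}
    (ht : T ≤ t) : Function.rightLim f t = y := by
  apply rightLim_eq_of_tendsto
  refine tendsto_const_nhds.congr' ?_
  filter_upwards [self_mem_nhdsWithin] with s hs
  exact (h s (ht.trans (le_of_lt hs))).symm

theorem rightLim_eq_of_forall_le {f : ℝ → ℝ} {y : ℝ} (h : ∀ t, t ≤ 0 → f t = y) {t : ℝ}
    (ht : t < 0) : Function.rightLim f t = y := by
  apply rightLim_eq_of_tendsto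
  refine tendsto_const_nhds.congr' ?_
  filter_upwards [nhdsWithin_le_nhds (Iio_mem_nhds ht)] with s hs
  exact (h s (le_of_lt hs)).symm

/-- The pattern measure of a compact image is supported in a bounded interval. -/
theorem exists_ae_mem_Icc {I : Set Plane} (hI : IsCompact I) (B : ConvexBody Plane) :
    ∃ T : ℝ, ∀ᵐ t ∂(patternMeasure I B), t ∈ Set.Icc 0 T := by
  obtain ⟨T, -, h⟩ := exists_opening_eq hI B
  refine ⟨T, ?_⟩
  have hge : ∀ t, T ≤ t → patternSpectrum I B t = patternSpectrum I B T := fun t ht => by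
    simp only [patternSpectrum, sizeDistribution, h t ht]
  have h1 : ∀ k : ℕ, patternMeasure I B (Set.Ioc T (T + k)) = 0 := fun k => by
    rw [patternMeasure_Ioc hI, rightLim_eq_of_forall_ge hge le_rfl,
      rightLim_eq_of_forall_ge hge (by simp), sub_self, ENNReal.ofReal_zero]
  -- These intervals exhaust the negative axis but stop short of `0`, since the right limit at `0`
  -- sees positive sizes. For `k = 0` the interval is empty.
  have h2 : ∀ k : ℕ, patternMeasure I B (Set.Ioc (-(k : ℝ)) (-(1 / ((k : ℝ) + 1)))) = 0 := by
    intro k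
    rcases k.eq_zero_or_pos with rfl | hk
    · simp
    have hk' : (0 : ℝ) < k := by exact_mod_cast hk
    rw [patternMeasure_Ioc hI,
      rightLim_eq_of_forall_le (fun t ht => patternSpectrum_of_nonpos I B ht)
        (neg_lt_zero.2 (by positivity)),
      rightLim_eq_of_forall_le (fun t ht => patternSpectrum_of_nonpos I B ht)
        (neg_lt_zero.2 hk'), sub_self, ENNReal.ofReal_zero]
  refine measure_mono_null ?_ (measure_union_null (measure_iUnion_null h1) (measure_iUnion_null h2))
  intro t ht
  rw [Set.mem_compl_iff, Set.mem_ofPred_eq, Set.mem_Icc, not_and_or, not_le, not_le] at ht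
  rcases ht with ht | ht
  · right
    obtain ⟨k₁, hk₁⟩ := exists_nat_gt (-t)
    obtain ⟨k₂, hk₂⟩ := exists_nat_one_div_lt (neg_pos.2 ht)
    refine Set.mem_iUnion.2 ⟨max k₁ k₂, ?_, ?_⟩
    · have : (k₁ : ℝ) ≤ ((max k₁ k₂ : ℕ) : ℝ) := by exact_mod_cast le_max_left _ _
      linarith
    · have h3 : (k₂ : ℝ) ≤ ((max k₁ k₂ : ℕ) : ℝ) := by exact_mod_cast le_max_right _ _
      have := one_div_le_one_div_of_le (by positivity) (add_le_add_left h3 1)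
      linarith
  · left
    obtain ⟨k, hk⟩ := exists_nat_gt (t - T)
    exact Set.mem_iUnion.2 ⟨k, ht, by linarith⟩

theorem integrable_pow_patternMeasure {I : Set Plane} (hI : IsCompact I) (B : ConvexBody Plane)
    (k : ℕ) : Integrable (fun t : ℝ => t ^ k) (patternMeasure I B) := by
  obtain ⟨T, hT⟩ := exists_ae_mem_Icc hI B
  rw [← Measure.restrict_eq_self_of_ae_mem hT]
  exact (continuous_pow k).integrableOn_Icc

theorem granulometricMoment_grainImage (hA : ∀ i, IsCompact (A i)) (hA1 : ∀ i, volume (A i) = 1)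
    (hr : ∀ p, 0 ≤ r p) (hd : Pairwise fun p q => Disjoint (grain A r c p) (grain A r c q))
    (B : ConvexBody Plane) (k : ℕ) :
    granulometricMoment k (grainImage A r c) B
      = ∑ p, r p ^ (k + 2) / (∑ q, r q ^ 2) * granulometricMoment k (A p.1) B := by
  have hcomp : ∀ p : Σ i, Fin (n i), (fun t : ℝ => (t * r p) ^ k) = fun t => t ^ k * r p ^ k :=
    fun p => funext fun t => mul_pow _ _ _
  have hint : ∀ p, Integrable (fun t : ℝ => t ^ k)
      ((patternMeasure (A p.1) B).map (· * r p)) := by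
    intro p
    rw [integrable_map_measure (by fun_prop) (by fun_prop)]
    change Integrable (fun t : ℝ => (t * r p) ^ k) _
    rw [hcomp]
    exact (integrable_pow_patternMeasure (hA p.1) B k).mul_const _
  rw [granulometricMoment, patternMeasure_grainImage hA hA1 hr hd,
    integral_finsetSum_measure fun p _ => (hint p).smul_measure ENNReal.ofReal_ne_top]
  refine Finset.sum_congr rfl fun p _ => ?_
  rw [integral_smul_measure, integral_map (by fun_prop) (by fun_prop), hcomp, integral_mul_const,
    ENNReal.toReal_ofReal (div_nonneg (sq_nonneg _) (Finset.sum_nonneg fun q _ => sq_nonneg _)),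
    granulometricMoment, smul_eq_mul]
  ring

/-- The radii enter each moment only through ratios that do not depend on the structuring element,
so grouping the grains by type gives a linear system with matrix `M`. -/
theorem momentVector_grainImage (hA : ∀ i, IsCompact (A i)) (hA1 : ∀ i, volume (A i) = 1)
    (hr : ∀ p, 0 ≤ r p) (hd : Pairwise fun p q => Disjoint (grain A r c p) (grain A r c q))
    (B : Fin 2 → ConvexBody Plane) :
    momentVector B (grainImage A r c) = primitiveMatrix A B *ᵥ
      Sum.elim (fun i => radiiRatio r i 1) (fun i => radiiRatio r i 2) := by
  have key : ∀ j k, granulometricMoment k (grainImage A r c) (B j)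
      = ∑ i, granulometricMoment k (A i) (B j) * radiiRatio r i k := by
    intro j k
    rw [granulometricMoment_grainImage hA hA1 hr hd, Fintype.sum_sigma]
    refine Finset.sum_congr rfl fun i _ => ?_
    rw [radiiRatio, Finset.sum_div, Finset.mul_sum]
    exact Finset.sum_congr rfl fun j _ => mul_comm _ _
  ext (j | j) <;> fin_cases j <;>
    simp [momentVector, primitiveMatrix, Matrix.mulVec, dotProduct, key]

theorem featureVector_grainImage (hA : ∀ i, IsCompact (A i)) (hA1 : ∀ i, volume (A i) = 1)
    {B : Fin 2 → ConvexBody Plane} (hM : IsUnit (primitiveMatrix A B).det)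
    (hr : ∀ p, 0 ≤ r p) (hd : Pairwise fun p q => Disjoint (grain A r c p) (grain A r c q)) :
    featureVector A B (grainImage A r c) =
      Sum.elim (fun i => radiiRatio r i 1) (fun i => radiiRatio r i 2) := by
  rw [featureVector, momentVector_grainImage hA hA1 hr hd, Matrix.mulVec_mulVec,
    Matrix.nonsing_inv_mul _ hM, Matrix.one_mulVec]

end Image

/-! ### A central limit theorem for sums of two independent groups -/

theorem tendsto_charFun_inv_sqrt_mul_pow_variance {Ω : Type*} [MeasurableSpace Ω] {P : Measure Ω}
    [IsProbabilityMeasure P] {X : Ω → ℝ} (hX : MemLp X 2 P) (h0 : ∫ ω, X ω ∂P = 0) (t : ℝ) :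
    Tendsto (fun n : ℕ => charFun (P.map X) ((√n)⁻¹ * t) ^ n) atTop
      (𝓝 (Complex.exp (-((Var[X; P] * t ^ 2 / 2 : ℝ) : ℂ)))) := by
  have hXm : AEMeasurable X P := hX.aestronglyMeasurable.aemeasurable
  by_cases hv : Var[X; P] = 0
  · have hX0 : X =ᵐ[P] fun _ => (0 : ℝ) := by
      have := ae_eq_integral_of_variance_eq_zero hX hv
      rwa [h0] at this
    rw [Measure.map_congr hX0, hv]
    simp
  · have hvpos : 0 < Var[X; P] := lt_of_le_of_ne (variance_nonneg _ _) (Ne.symm hv)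
    have hs : √(Var[X; P]) ≠ 0 := (Real.sqrt_pos.2 hvpos).ne'
    have hY : AEMeasurable (fun ω => (√Var[X; P])⁻¹ * X ω) P := hXm.const_mul _
    have h := tendsto_charFun_inv_sqrt_mul_pow hY (by rw [integral_const_mul, h0, mul_zero])
      (by
        simp only [Pi.pow_apply, mul_pow]
        rw [integral_const_mul, inv_pow, Real.sq_sqrt hvpos.le,
          ← variance_of_integral_eq_zero hXm h0, inv_mul_cancel₀ hv])
      -- The variable scaled to unit variance is evaluated at `√Var * t`, which undoes the scaling.
      (√Var[X; P] * t)
    simp only [charFun_map_mul_comp hXm] at h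
    convert h using 2
    · next n =>
      congr 2
      field_simp
    · congr 1
      push_cast
      rw [mul_pow, ← Complex.ofReal_pow (√_), Real.sq_sqrt hvpos.le]
      ring

section TwoGroups

variable {b : Fin 2 → ℝ} {n : ℕ → Fin 2 → ℕ}

theorem proportion_nonneg
    (hb : ∀ l i, (n l i : ℝ) = b i * ((n l 0 + n l 1 : ℕ) : ℝ))
    (hN : Tendsto (fun l => n l 0 + n l 1) atTop atTop) (i : Fin 2) : 0 ≤ b i := by
  obtain ⟨l, hl⟩ := (hN.eventually_gt_atTop 0).exists
  have hl' : (0 : ℝ) < ((n l 0 + n l 1 : ℕ) : ℝ) := by exact_mod_cast hl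
  have : 0 ≤ b i * ((n l 0 + n l 1 : ℕ) : ℝ) := by rw [← hb]; positivity
  exact nonneg_of_mul_nonneg_left this hl'

theorem tendsto_group_size
    (hb : ∀ l i, (n l i : ℝ) = b i * ((n l 0 + n l 1 : ℕ) : ℝ))
    (hN : Tendsto (fun l => n l 0 + n l 1) atTop atTop) {i : Fin 2} (hi : 0 < b i) :
    Tendsto (fun l => n l i) atTop atTop := by
  rw [← tendsto_natCast_atTop_iff (R := ℝ)]
  simp only [hb _ i]
  exact (tendsto_natCast_atTop_atTop.comp hN).const_mul_atTop hi

theorem group_size_eq_zero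
    (hb : ∀ l i, (n l i : ℝ) = b i * ((n l 0 + n l 1 : ℕ) : ℝ)) {i : Fin 2} (hi : b i = 0)
    (l : ℕ) : n l i = 0 := by
  have := hb l i
  rw [hi, zero_mul] at this
  exact_mod_cast this

/-- By independence the characteristic function is a product of `n l i`-th powers, and `N^(-1/2) =
n_i^(-1/2) √b_i` turns each factor into a one-dimensional central limit theorem at `√b_i`. A group
with `b i = 0` is empty and contributes `1`. -/
theorem tendsto_charFun_two_groups
    (hb : ∀ l i, (n l i : ℝ) = b i * ((n l 0 + n l 1 : ℕ) : ℝ))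
    (hN : Tendsto (fun l => n l 0 + n l 1) atTop atTop)
    {ρ : Fin 2 → Measure ℝ} [∀ i, IsProbabilityMeasure (ρ i)] {h : Fin 2 → ℝ → ℝ}
    (hL2 : ∀ i, MemLp (h i) 2 (ρ i)) (h0 : ∀ i, ∫ s, h i s ∂(ρ i) = 0)
    {Ω : ℕ → Type*} [∀ l, MeasurableSpace (Ω l)] {P : (l : ℕ) → Measure (Ω l)}
    [∀ l, IsProbabilityMeasure (P l)] {X : (l : ℕ) → (Σ i, Fin (n l i)) → Ω l → ℝ}
    (hlaw : ∀ l p, HasLaw (X l p) ((ρ p.1).map (h p.1)) (P l))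
    (hindep : ∀ l, iIndepFun (X l) (P l)) :
    Tendsto (fun l => charFun ((P l).map fun ω => ∑ p, X l p ω)
        (√((n l 0 + n l 1 : ℕ) : ℝ))⁻¹) atTop
      (𝓝 (Complex.exp (-((∑ i, b i * Var[h i; ρ i]) / 2 : ℝ)))) := by
  have heq : ∀ l, charFun ((P l).map fun ω => ∑ p, X l p ω) (√((n l 0 + n l 1 : ℕ) : ℝ))⁻¹
      = ∏ i, charFun ((ρ i).map (h i)) ((√((n l i : ℕ) : ℝ))⁻¹ * √(b i)) ^ (n l i) := by
    intro l
    rw [iIndepFun.charFun_map_fun_finsetSum_eq_prod (s := Finset.univ)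
      (fun p _ => (hlaw l p).aemeasurable) ((hindep l).restrict _), Finset.prod_apply,
      Fintype.prod_sigma]
    refine Finset.prod_congr rfl fun i _ => ?_
    simp only [(hlaw l _).map_eq, Finset.prod_const, Finset.card_univ, Fintype.card_fin]
    rcases (proportion_nonneg hb hN i).eq_or_lt with hi | hi
    · rw [group_size_eq_zero hb hi.symm, pow_zero, pow_zero]
    · congr 2
      rw [hb l i, Real.sqrt_mul hi.le, mul_inv, mul_right_comm,
        inv_mul_cancel₀ (Real.sqrt_pos.2 hi).ne', one_mul]
  simp only [heq]
  have hlim : Complex.exp (-((∑ i, b i * Var[h i; ρ i]) / 2 : ℝ))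
      = ∏ i, Complex.exp (-((Var[h i; ρ i] * √(b i) ^ 2 / 2 : ℝ) : ℂ)) := by
    rw [← Complex.exp_sum, Fin.sum_univ_two, Fin.sum_univ_two,
      Real.sq_sqrt (proportion_nonneg hb hN 0), Real.sq_sqrt (proportion_nonneg hb hN 1)]
    congr 1
    push_cast
    ring
  rw [hlim]
  refine tendsto_finsetProd _ fun i _ => ?_
  rcases (proportion_nonneg hb hN i).eq_or_lt with hi | hi
  · simp [group_size_eq_zero hb hi.symm, ← hi]
  · exact (tendsto_charFun_inv_sqrt_mul_pow_variance (hL2 i) (h0 i) (√(b i))).comp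
      (tendsto_group_size hb hN hi)

/-- The strong law of large numbers for two groups of independent variables, whose sizes are in
fixed proportions. -/
theorem tendsto_average_two_groups
    (hb : ∀ l i, (n l i : ℝ) = b i * ((n l 0 + n l 1 : ℕ) : ℝ))
    (hN : Tendsto (fun l => n l 0 + n l 1) atTop atTop)
    {W : Type*} [MeasurableSpace W] {Q : Measure W} {Y : Fin 2 → ℕ → W → ℝ}
    (hint : ∀ i, Integrable (Y i 0) Q)
    (hindep : ∀ i, Pairwise (Function.onFun (fun f g => IndepFun f g Q) (Y i)))
    (hident : ∀ i j, IdentDistrib (Y i j) (Y i 0) Q Q) :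
    ∀ᵐ ω ∂Q, Tendsto (fun l => (∑ p : Σ i, Fin (n l i), Y p.1 p.2 ω) / ((n l 0 + n l 1 : ℕ) : ℝ))
      atTop (𝓝 (∑ i, b i * ∫ ω, Y i 0 ω ∂Q)) := by
  have h : ∀ᵐ ω ∂Q, ∀ i, Tendsto (fun k : ℕ => (∑ j ∈ Finset.range k, Y i j ω) / k) atTop
      (𝓝 (∫ ω, Y i 0 ω ∂Q)) :=
    ae_all_iff.2 fun i => strong_law_ae_real (Y i) (hint i) (hindep i) (hident i)
  filter_upwards [h] with ω hω
  have heq : ∀ l, (∑ p : Σ i, Fin (n l i), Y p.1 p.2 ω) / ((n l 0 + n l 1 : ℕ) : ℝ)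
      = ∑ i, b i * ((∑ j ∈ Finset.range (n l i), Y i j ω) / (n l i : ℕ)) := by
    intro l
    rw [Fintype.sum_sigma, Finset.sum_div]
    refine Finset.sum_congr rfl fun i _ => ?_
    rw [Fin.sum_univ_eq_sum_range (fun j => Y i j ω) (n l i)]
    rcases eq_or_ne (b i) 0 with hi | hi
    · simp [group_size_eq_zero hb hi, hi]
    · rw [hb l i, ← mul_div_assoc, mul_div_mul_left _ _ hi]
  simp only [heq]
  refine tendsto_finsetSum _ fun i _ => ?_
  rcases (proportion_nonneg hb hN i).eq_or_lt with hi | hi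
  · simp [← hi]
  · exact ((hω i).comp (tendsto_group_size hb hN hi)).const_mul _

end TwoGroups

/-! ### The linearized feature vector and its covariance -/

/-- The contribution of a grain of type `q` and radius `s` to the pairing with `x` of the
linearization at `m` of the radii ratios. -/
def influence (m x : Fin 2 ⊕ Fin 2 → ℝ) (q : Fin 2) (s : ℝ) : ℝ :=
  x (Sum.inl q) * s ^ 3 + x (Sum.inr q) * s ^ 4 - (x ⬝ᵥ m) * s ^ 2

theorem measurable_influence (m x : Fin 2 ⊕ Fin 2 → ℝ) (q : Fin 2) :
    Measurable (influence m x q) := by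
  unfold influence
  fun_prop

section Moments

variable {ρ : Fin 2 → Measure ℝ}  {γ : Fin 2 → ℕ → ℝ} {β : ℝ} {b : Fin 2 → ℝ}

theorem memLp_influence
    (hint : ∀ i, ∀ k ∈ Finset.Icc 2 8, Integrable (fun s : ℝ => s ^ k) (ρ i))
    (m x : Fin 2 ⊕ Fin 2 → ℝ) (q : Fin 2) : MemLp (influence m x q) 2 (ρ q) := by
  have h : ∀ k ∈ Finset.Icc 2 4, MemLp (fun s : ℝ => s ^ k) 2 (ρ q) := by
    intro k hk
    rw [memLp_two_iff_integrable_sq (by fun_prop)]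
    simp only [← pow_mul]
    exact hint q _ (by simp only [Finset.mem_Icc] at hk ⊢; omega)
  exact (((h 3 (by simp)).const_mul _).add ((h 4 (by simp)).const_mul _)).sub
    ((h 2 (by simp)).const_mul _)

theorem integral_influence
    (hint : ∀ i, ∀ k ∈ Finset.Icc 2 8, Integrable (fun s : ℝ => s ^ k) (ρ i))
    (hmom : ∀ i, ∀ k ∈ Finset.Icc 2 8, ∫ s, s ^ k ∂(ρ i) = γ i k * β ^ k)
    (m x : Fin 2 ⊕ Fin 2 → ℝ) (q : Fin 2) :
    ∫ s, influence m x q s ∂(ρ q) = x (Sum.inl q) * (γ q 3 * β ^ 3)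
      + x (Sum.inr q) * (γ q 4 * β ^ 4) - (x ⬝ᵥ m) * (γ q 2 * β ^ 2) := by
  have i2 := hint q 2 (by simp)
  have i3 := hint q 3 (by simp)
  have i4 := hint q 4 (by simp)
  unfold influence
  rw [integral_sub ((i3.const_mul _).fun_add (i4.const_mul _)) (i2.const_mul _),
    integral_add (i3.const_mul _) (i4.const_mul _), integral_const_mul, integral_const_mul,
    integral_const_mul, hmom q 2 (by simp), hmom q 3 (by simp), hmom q 4 (by simp)]

theorem integral_influence_sq
    (hint : ∀ i, ∀ k ∈ Finset.Icc 2 8, Integrable (fun s : ℝ => s ^ k) (ρ i))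
    (hmom : ∀ i, ∀ k ∈ Finset.Icc 2 8, ∫ s, s ^ k ∂(ρ i) = γ i k * β ^ k)
    (m x : Fin 2 ⊕ Fin 2 → ℝ) (q : Fin 2) :
    ∫ s, influence m x q s ^ 2 ∂(ρ q) =
      x (Sum.inl q) ^ 2 * (γ q 6 * β ^ 6) + x (Sum.inr q) ^ 2 * (γ q 8 * β ^ 8)
      + (x ⬝ᵥ m) ^ 2 * (γ q 4 * β ^ 4)
      + 2 * x (Sum.inl q) * x (Sum.inr q) * (γ q 7 * β ^ 7)
      + -2 * x (Sum.inl q) * (x ⬝ᵥ m) * (γ q 5 * β ^ 5)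
      + -2 * x (Sum.inr q) * (x ⬝ᵥ m) * (γ q 6 * β ^ 6) := by
  have hk : ∀ k ∈ Finset.Icc 2 8, ∀ a : ℝ, Integrable (fun s : ℝ => a * s ^ k) (ρ q) :=
    fun k hk a => (hint q k hk).const_mul a
  have hex : ∀ s, influence m x q s ^ 2 =
      x (Sum.inl q) ^ 2 * s ^ 6 + x (Sum.inr q) ^ 2 * s ^ 8 + (x ⬝ᵥ m) ^ 2 * s ^ 4
      + 2 * x (Sum.inl q) * x (Sum.inr q) * s ^ 7 + -2 * x (Sum.inl q) * (x ⬝ᵥ m) * s ^ 5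
      + -2 * x (Sum.inr q) * (x ⬝ᵥ m) * s ^ 6 := by
    intro s
    unfold influence
    ring
  have h1 := hk 6 (by simp) (x (Sum.inl q) ^ 2)
  have h2 := h1.fun_add (hk 8 (by simp) (x (Sum.inr q) ^ 2))
  have h3 := h2.fun_add (hk 4 (by simp) ((x ⬝ᵥ m) ^ 2))
  have h4 := h3.fun_add (hk 7 (by simp) (2 * x (Sum.inl q) * x (Sum.inr q)))
  have h5 := h4.fun_add (hk 5 (by simp) (-2 * x (Sum.inl q) * (x ⬝ᵥ m)))
  simp only [hex]
  rw [integral_add h5 (hk 6 (by simp) _), integral_add h4 (hk 5 (by simp) _),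
    integral_add h3 (hk 7 (by simp) _), integral_add h2 (hk 4 (by simp) _),
    integral_add h1 (hk 8 (by simp) _)]
  simp only [integral_const_mul]
  rw [hmom q 4 (by simp), hmom q 5 (by simp), hmom q 6 (by simp), hmom q 7 (by simp),
    hmom q 8 (by simp)]

/-- For a radius `s` of type `q`, `constC γ i j q * β ^ (i + j + 4)` is the covariance of `s ^ (i +
2)` and `s ^ (j + 2)`; the formula expands the variance of a combination of `s ^ 2`, `s ^ 3`, `s ^
4`. -/
theorem variance_influence [∀ i, IsProbabilityMeasure (ρ i)]
    (hint : ∀ i, ∀ k ∈ Finset.Icc 2 8, Integrable (fun s : ℝ => s ^ k) (ρ i))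
    (hmom : ∀ i, ∀ k ∈ Finset.Icc 2 8, ∫ s, s ^ k ∂(ρ i) = γ i k * β ^ k)
    (m x : Fin 2 ⊕ Fin 2 → ℝ) (q : Fin 2) :
    Var[influence m x q; ρ q] =
      x (Sum.inl q) ^ 2 * constC γ 1 1 q * β ^ 6 + x (Sum.inr q) ^ 2 * constC γ 2 2 q * β ^ 8
      + (x ⬝ᵥ m) ^ 2 * constC γ 0 0 q * β ^ 4
      + 2 * x (Sum.inl q) * x (Sum.inr q) * constC γ 1 2 q * β ^ 7
      - 2 * x (Sum.inl q) * (x ⬝ᵥ m) * constC γ 0 1 q * β ^ 5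
      - 2 * x (Sum.inr q) * (x ⬝ᵥ m) * constC γ 0 2 q * β ^ 6 := by
  rw [variance_eq_sub (memLp_influence hint m x q)]
  simp only [Pi.pow_apply]
  rw [integral_influence_sq hint hmom, integral_influence hint hmom]
  unfold constC
  norm_num
  ring

/-- This is what singles out `m`: it is the ratio of the mean numerators to the mean denominator
`Dβ²`. The two types need not be centered separately; only the weighted sum vanishes. -/
theorem sum_integral_influence
    (hint : ∀ i, ∀ k ∈ Finset.Icc 2 8, Integrable (fun s : ℝ => s ^ k) (ρ i))
    (hmom : ∀ i, ∀ k ∈ Finset.Icc 2 8, ∫ s, s ^ k ∂(ρ i) = γ i k * β ^ k)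
    (hD : meanSquare b γ ≠ 0) (x : Fin 2 ⊕ Fin 2 → ℝ) :
    ∑ q, b q * ∫ s, influence (asympMean b γ β) x q s ∂(ρ q) = 0 := by
  have hκ : meanSquare b γ * (x ⬝ᵥ asympMean b γ β) =
      x (Sum.inl 0) * b 0 * γ 0 3 * β + x (Sum.inl 1) * b 1 * γ 1 3 * β
      + x (Sum.inr 0) * b 0 * γ 0 4 * β ^ 2 + x (Sum.inr 1) * b 1 * γ 1 4 * β ^ 2 := by
    simp [asympMean, dotProduct]
    field_simp
    ring
  simp only [integral_influence hint hmom, Fin.sum_univ_two]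
  unfold meanSquare at hκ
  linear_combination (-β ^ 2) * hκ

/-- The identity that justifies the explicit `Σ`: once powers of `D` are cleared, both sides are the
same polynomial in the proportions, the `γ`, the `constC`, `β` and `x`. -/
theorem dotProduct_asympCov_mulVec [∀ i, IsProbabilityMeasure (ρ i)]
    (hint : ∀ i, ∀ k ∈ Finset.Icc 2 8, Integrable (fun s : ℝ => s ^ k) (ρ i))
    (hmom : ∀ i, ∀ k ∈ Finset.Icc 2 8, ∫ s, s ^ k ∂(ρ i) = γ i k * β ^ k)
    (hD : meanSquare b γ ≠ 0) (x : Fin 2 ⊕ Fin 2 → ℝ) :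
    (meanSquare b γ * β ^ 2) ^ 2 * (x ⬝ᵥ asympCov b γ β *ᵥ x) =
      ∑ q, b q * Var[influence (asympMean b γ β) x q; ρ q] := by
  have hκ : x ⬝ᵥ asympMean b γ β =
      (x (Sum.inl 0) * b 0 * γ 0 3 * β + x (Sum.inl 1) * b 1 * γ 1 3 * β
      + x (Sum.inr 0) * b 0 * γ 0 4 * β ^ 2 + x (Sum.inr 1) * b 1 * γ 1 4 * β ^ 2)
        / meanSquare b γ := by
    simp [asympMean, dotProduct]
    field_simp
    ring
  have hquad : x ⬝ᵥ asympCov b γ β *ᵥ x = (∑ i, ∑ j,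
      (x (Sum.inl i) * x (Sum.inl j) * β ^ 2 * blockA b γ 1 1 i j
      + x (Sum.inl i) * x (Sum.inr j) * β ^ 3 * blockA b γ 1 2 i j
      + x (Sum.inr i) * x (Sum.inl j) * β ^ 3 * blockA b γ 2 1 i j
      + x (Sum.inr i) * x (Sum.inr j) * β ^ 4 * blockA b γ 2 2 i j)) / meanSquare b γ ^ 4 := by
    simp only [asympCov, Matrix.smul_mulVec, dotProduct_smul, smul_eq_mul, one_div]
    rw [inv_mul_eq_div]
    congr 1
    simp only [dotProduct, Matrix.mulVec, Fintype.sum_sum_type, Fin.sum_univ_two,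
      Matrix.fromBlocks_apply₁₁, Matrix.fromBlocks_apply₁₂, Matrix.fromBlocks_apply₂₁,
      Matrix.fromBlocks_apply₂₂, Matrix.smul_apply, smul_eq_mul]
    ring
  rw [hquad]
  simp only [variance_influence hint hmom, hκ, Fin.sum_univ_two]
  simp only [blockA, Matrix.add_apply, Matrix.of_apply, Matrix.cons_val', Matrix.cons_val_zero,
    Matrix.cons_val_one, Matrix.cons_val_fin_one]
  field_simp
  simp only [constB]
  -- `D` stays opaque until the denominators are cleared, because only `D ≠ 0` is known. The
  -- symmetry of `constC` then lets `ring` identify equal covariances.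
  unfold meanSquare
  simp only [show constC γ 1 0 = constC γ 0 1 from by ext; simp [constC, mul_comm],
    show constC γ 2 0 = constC γ 0 2 from by ext; simp [constC, mul_comm],
    show constC γ 2 1 = constC γ 1 2 from by ext; simp [constC, mul_comm]]
  ring

theorem isHermitian_asympCov : (asympCov b γ β).IsHermitian := by
  have h : ∀ i j, (blockA b γ i j)ᵀ = blockA b γ j i := by
    intro i j
    ext k l
    fin_cases k <;> fin_cases l <;>
      simp [blockA, constB, constC, -mul_eq_mul_left_iff] <;> ring_nf
  rw [Matrix.IsHermitian, Matrix.conjTranspose_eq_transpose_of_trivial, asympCov,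
    Matrix.transpose_smul, Matrix.fromBlocks_transpose]
  simp only [Matrix.transpose_smul, h]

theorem posSemidef_asympCov [∀ i, IsProbabilityMeasure (ρ i)]
    (hint : ∀ i, ∀ k ∈ Finset.Icc 2 8, Integrable (fun s : ℝ => s ^ k) (ρ i))
    (hmom : ∀ i, ∀ k ∈ Finset.Icc 2 8, ∫ s, s ^ k ∂(ρ i) = γ i k * β ^ k)
    (hD : meanSquare b γ ≠ 0) (hβ : β ≠ 0) (hb : ∀ i, 0 ≤ b i) :
    (asympCov b γ β).PosSemidef := by
  refine Matrix.PosSemidef.of_dotProduct_mulVec_nonneg isHermitian_asympCov fun x => ?_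
  rw [star_trivial]
  have h := dotProduct_asympCov_mulVec hint hmom hD x
  have h1 : 0 ≤ ∑ q, b q * Var[influence (asympMean b γ β) x q; ρ q] :=
    Finset.sum_nonneg fun q _ => mul_nonneg (hb q) (variance_nonneg _ _)
  rw [← h] at h1
  exact nonneg_of_mul_nonneg_right h1 (by positivity)

end Moments

/-! ### Asymptotic normality of the radii ratios -/

/-- The vector of the radii ratios, centered at `m` and scaled by the square root of the number
of grains. -/
noncomputable def scaledRatio {n : Fin 2 → ℕ} (m : Fin 2 ⊕ Fin 2 → ℝ)
    (r : (Σ i, Fin (n i)) → ℝ) : EuclideanSpace ℝ (Fin 2 ⊕ Fin 2) :=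
  WithLp.toLp 2 (√((n 0 + n 1 : ℕ) : ℝ) •
    (Sum.elim (fun i => radiiRatio r i 1) (fun i => radiiRatio r i 2) - m))

/-- The linearization of `scaledRatio`, up to the factor `N / ∑ₚ r_p²`. -/
noncomputable def linearizedRatio {n : Fin 2 → ℕ} (m : Fin 2 ⊕ Fin 2 → ℝ)
    (r : (Σ i, Fin (n i)) → ℝ) : EuclideanSpace ℝ (Fin 2 ⊕ Fin 2) :=
  WithLp.toLp 2 ((√((n 0 + n 1 : ℕ) : ℝ))⁻¹ •
    (Sum.elim (fun i => ∑ j : Fin (n i), r ⟨i, j⟩ ^ 3) (fun i => ∑ j : Fin (n i), r ⟨i, j⟩ ^ 4)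
      - (∑ p, r p ^ 2) • m))

section Ratio

variable {n : Fin 2 → ℕ} (m : Fin 2 ⊕ Fin 2 → ℝ)

theorem measurable_scaledRatio : Measurable (scaledRatio (n := n) m) := by
  unfold scaledRatio
  refine (WithLp.measurable_toLp 2 _).comp (measurable_pi_lambda _ fun k => ?_)
  rcases k with i | i <;>
  · simp only [Pi.smul_apply, Pi.sub_apply, Sum.elim_inl, Sum.elim_inr, radiiRatio]
    fun_prop

theorem measurable_linearizedRatio : Measurable (linearizedRatio (n := n) m) := by
  unfold linearizedRatio
  refine (WithLp.measurable_toLp 2 _).comp (measurable_pi_lambda _ fun k => ?_)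
  rcases k with i | i <;>
  · simp only [Pi.smul_apply, Pi.sub_apply, Sum.elim_inl, Sum.elim_inr]
    fun_prop

theorem scaledRatio_eq {r : (Σ i, Fin (n i)) → ℝ} (hr : ∑ p, r p ^ 2 ≠ 0) :
    scaledRatio m r
      = ((∑ p, r p ^ 2) / ((n 0 + n 1 : ℕ) : ℝ))⁻¹ • linearizedRatio m r := by
  have h : √((n 0 + n 1 : ℕ) : ℝ)
      = ((n 0 + n 1 : ℕ) : ℝ) * (√((n 0 + n 1 : ℕ) : ℝ))⁻¹ := by
    rw [← div_eq_mul_inv, Real.div_sqrt]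
  rw [scaledRatio, linearizedRatio, ← WithLp.toLp_smul, smul_smul, inv_div]
  congr 1
  ext (i | i) <;>
  · simp only [Pi.smul_apply, Pi.sub_apply, Sum.elim_inl, Sum.elim_inr, smul_eq_mul, radiiRatio]
    nth_rewrite 1 [h]
    field_simp

theorem inner_linearizedRatio (r : (Σ i, Fin (n i)) → ℝ)
    (t : EuclideanSpace ℝ (Fin 2 ⊕ Fin 2)) :
    inner ℝ (linearizedRatio m r) t
      = (√((n 0 + n 1 : ℕ) : ℝ))⁻¹ * ∑ p, influence m t p.1 (r p) := by
  have h : ∑ p, influence m t p.1 (r p)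
      = ∑ i, (t (Sum.inl i) * ∑ j : Fin (n i), r ⟨i, j⟩ ^ 3)
        + ∑ i, (t (Sum.inr i) * ∑ j : Fin (n i), r ⟨i, j⟩ ^ 4)
        - ((t : Fin 2 ⊕ Fin 2 → ℝ) ⬝ᵥ m) * ∑ p, r p ^ 2 := by
    simp only [influence, Finset.sum_sub_distrib, Finset.sum_add_distrib, ← Finset.mul_sum]
    congr 1
    simp only [Fintype.sum_sigma, Finset.mul_sum]
  rw [h, linearizedRatio, PiLp.inner_apply]
  simp only [Pi.smul_apply, Pi.sub_apply, Fintype.sum_sum_type, Sum.elim_inl,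
    Sum.elim_inr, smul_eq_mul, Fin.sum_univ_two, RCLike.inner_apply, conj_trivial, dotProduct]
  ring

end Ratio

/-! ### Limit law of the linear part, then of the ratios -/

section Limit

variable {ρ : Fin 2 → Measure ℝ} [∀ i, IsProbabilityMeasure (ρ i)]
  {γ : Fin 2 → ℕ → ℝ} {β : ℝ} {b : Fin 2 → ℝ} {n : ℕ → Fin 2 → ℕ}
  {Ω : ℕ → Type*} [∀ l, MeasurableSpace (Ω l)] {P : (l : ℕ) → Measure (Ω l)}
  [∀ l, IsProbabilityMeasure (P l)] {r : (l : ℕ) → (Σ i, Fin (n l i)) → Ω l → ℝ}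

/-- By Lévy's continuity theorem it is enough to treat each `t`; there the characteristic function
is that of a scalar sum over grains, evaluated at `N^(-1/2)`. -/
theorem tendstoInDistribution_linearizedRatio (hβ : β ≠ 0)
    (hint : ∀ i, ∀ k ∈ Finset.Icc 2 8, Integrable (fun s : ℝ => s ^ k) (ρ i))
    (hmom : ∀ i, ∀ k ∈ Finset.Icc 2 8, ∫ s, s ^ k ∂(ρ i) = γ i k * β ^ k)
    (hb : ∀ l i, (n l i : ℝ) = b i * ((n l 0 + n l 1 : ℕ) : ℝ))
    (hN : Tendsto (fun l => n l 0 + n l 1) atTop atTop) (hD : meanSquare b γ ≠ 0)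
    (hlaw : ∀ l p, HasLaw (r l p) (ρ p.1) (P l)) (hindep : ∀ l, iIndepFun (r l) (P l)) :
    TendstoInDistribution
      (fun l ω => linearizedRatio (asympMean b γ β) fun p => r l p ω) atTop
      (fun x : EuclideanSpace ℝ (Fin 2 ⊕ Fin 2) => (meanSquare b γ * β ^ 2) • x) P
      (multivariateGaussian 0 (asympCov b γ β)) := by
  have hrm : ∀ l, AEMeasurable (fun ω p => r l p ω) (P l) := fun l =>
    aemeasurable_pi_lambda _ fun p => (hlaw l p).aemeasurable
  have hVm : ∀ l, AEMeasurable
      (fun ω => linearizedRatio (asympMean b γ β) fun p => r l p ω) (P l) := fun l =>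
    (measurable_linearizedRatio _).comp_aemeasurable (hrm l)
  refine ⟨hVm, by fun_prop, ?_⟩
  refine ProbabilityMeasure.tendsto_iff_tendsto_charFun.2 fun t => ?_
  change Tendsto
    (fun l => charFun ((P l).map fun ω => linearizedRatio (asympMean b γ β) fun p => r l p ω) t)
    atTop (𝓝 (charFun ((multivariateGaussian 0 (asympCov b γ β)).map
      fun x : EuclideanSpace ℝ (Fin 2 ⊕ Fin 2) => (meanSquare b γ * β ^ 2) • x) t))
  set m := asympMean b γ β with hm
  set ν : Fin 2 → ℝ := fun q => ∫ s, influence m t q s ∂(ρ q) with hν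
  set h : Fin 2 → ℝ → ℝ := fun q s => influence m t q s - ν q with hh
  have hhm : ∀ q, Measurable (h q) := fun q => (measurable_influence m t q).sub_const _
  have hL2 : ∀ q, MemLp (influence m t q) 2 (ρ q) := fun q => memLp_influence hint m t q
  have hhL2 : ∀ q, MemLp (h q) 2 (ρ q) := fun q => (hL2 q).sub (memLp_const _)
  have hh0 : ∀ q, ∫ s, h q s ∂(ρ q) = 0 := by
    intro q
    rw [integral_sub ((hL2 q).integrable one_le_two) (integrable_const _)]
    simp [hν]
  have hvar : ∀ q, Var[h q; ρ q] = Var[influence m t q; ρ q] := fun q =>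
    variance_sub_const (measurable_influence m t q).aestronglyMeasurable _
  have hclt := tendsto_charFun_two_groups (P := P) (X := fun l p ω => h p.1 (r l p ω)) hb hN
    hhL2 hh0
    (fun l p => HasLaw.comp ⟨(hhm p.1).aemeasurable, rfl⟩ (hlaw l p))
    (fun l => (hindep l).comp (fun p => h p.1) fun p => hhm p.1)
  have hleft : ∀ l, charFun ((P l).map fun ω => linearizedRatio m fun p => r l p ω) t
      = charFun ((P l).map fun ω => ∑ p, h p.1 (r l p ω)) (√((n l 0 + n l 1 : ℕ) : ℝ))⁻¹ := by
    intro l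
    have hsum : ∀ ω, ∑ p, h p.1 (r l p ω) = ∑ p, influence m t p.1 (r l p ω) := by
      intro ω
      -- Centering each type separately costs nothing: the group sizes are exactly `b i * N`, so the
      -- subtracted total is `N ∑ b i ν i = 0`.
      have h1 : ∑ p : Σ i, Fin (n l i), ν p.1 = 0 := by
        rw [Fintype.sum_sigma]
        simp only [Finset.sum_const, Finset.card_univ, Fintype.card_fin, nsmul_eq_mul]
        have h2 := sum_integral_influence hint hmom hD (t : Fin 2 ⊕ Fin 2 → ℝ)
        simp only [hb l, mul_right_comm _ ((n l 0 + n l 1 : ℕ) : ℝ), ← Finset.sum_mul]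
        rw [show ∑ i, b i * ν i = 0 from h2, zero_mul]
      rw [Finset.sum_sub_distrib, h1, sub_zero]
    have hSm : AEMeasurable (fun ω => ∑ p, h p.1 (r l p ω)) (P l) :=
      Finset.aemeasurable_fun_sum _ fun p _ =>
        (hhm p.1).comp_aemeasurable (hlaw l p).aemeasurable
    rw [charFun_apply, charFun_apply, integral_map (hVm l) (by fun_prop),
      integral_map hSm (by fun_prop)]
    refine integral_congr_ae (ae_of_all _ fun ω => ?_)
    simp only [inner_linearizedRatio, hsum, RCLike.inner_apply, conj_trivial]
  simp only [hleft]
  have hright : charFun ((multivariateGaussian 0 (asympCov b γ β)).map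
      fun x : EuclideanSpace ℝ (Fin 2 ⊕ Fin 2) => (meanSquare b γ * β ^ 2) • x) t
      = Complex.exp (-((∑ i, b i * Var[h i; ρ i]) / 2 : ℝ)) := by
    rw [charFun_map_smul, charFun_multivariateGaussian (posSemidef_asympCov hint hmom hD hβ
      (proportion_nonneg hb hN))]
    simp only [hvar, hm, ← dotProduct_asympCov_mulVec hint hmom hD]
    simp [Matrix.mulVec_smul]
    ring_nf
  rw [hright]
  exact hclt

theorem map_eq_pi_of_hasLaw {ι Ω : Type*} [Fintype ι] [MeasurableSpace Ω] {P : Measure Ω}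
    [IsProbabilityMeasure P] {ρ : ι → Measure ℝ} {r : ι → Ω → ℝ}
    (hlaw : ∀ p, HasLaw (r p) (ρ p) P) (hindep : iIndepFun r P) :
    P.map (fun ω p => r p ω) = Measure.pi ρ := by
  rw [(iIndepFun_iff_map_fun_eq_pi_map fun p => (hlaw p).aemeasurable).1 hindep]
  simp only [(hlaw _).map_eq]

/-- The almost sure law of large numbers needs a common probability space, whereas the images live
on unrelated ones. Convergence in distribution sees only laws, so the radii may be replaced by
coordinates of one infinite product. -/
theorem tendstoInDistribution_scaledRatio (hβ : β ≠ 0)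
    (hint : ∀ i, ∀ k ∈ Finset.Icc 2 8, Integrable (fun s : ℝ => s ^ k) (ρ i))
    (hmom : ∀ i, ∀ k ∈ Finset.Icc 2 8, ∫ s, s ^ k ∂(ρ i) = γ i k * β ^ k)
    (hb : ∀ l i, (n l i : ℝ) = b i * ((n l 0 + n l 1 : ℕ) : ℝ))
    (hN : Tendsto (fun l => n l 0 + n l 1) atTop atTop) (hD : 0 < meanSquare b γ)
    (hlaw : ∀ l p, HasLaw (r l p) (ρ p.1) (P l)) (hindep : ∀ l, iIndepFun (r l) (P l)) :
    TendstoInDistribution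
      (fun l ω => scaledRatio (asympMean b γ β) fun p => r l p ω) atTop
      (id : EuclideanSpace ℝ (Fin 2 ⊕ Fin 2) → EuclideanSpace ℝ (Fin 2 ⊕ Fin 2)) P
      (multivariateGaussian 0 (asympCov b γ β)) := by
  have hrm : ∀ l, AEMeasurable (fun ω p => r l p ω) (P l) := fun l =>
    aemeasurable_pi_lambda _ fun p => (hlaw l p).aemeasurable
  set m := asympMean b γ β with hm
  set κ := meanSquare b γ * β ^ 2 with hκ
  have hκ0 : κ ≠ 0 := mul_ne_zero hD.ne' (pow_ne_zero _ hβ)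
  -- all images are realized on one probability space
  let Q : Measure (Fin 2 × ℕ → ℝ) := Measure.infinitePi fun p => ρ p.1
  let R : (l : ℕ) → (Σ i, Fin (n l i)) → (Fin 2 × ℕ → ℝ) → ℝ := fun l p ω => ω (p.1, (p.2 : ℕ))
  have hQlaw : ∀ p, HasLaw (fun ω : Fin 2 × ℕ → ℝ => ω p) (ρ p.1) Q := fun p =>
    (measurePreserving_eval_infinitePi (fun p : Fin 2 × ℕ => ρ p.1) p).hasLaw
  have hQindep : iIndepFun (fun (p : Fin 2 × ℕ) (ω : Fin 2 × ℕ → ℝ) => ω p) Q :=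
    iIndepFun_infinitePi (X := fun _ x => x) fun _ => measurable_id
  have hRlaw : ∀ l p, HasLaw (R l p) (ρ p.1) Q := fun l p => hQlaw (p.1, (p.2 : ℕ))
  have hRindep : ∀ l, iIndepFun (R l) Q := fun l =>
    hQindep.precomp (g := fun p : Σ i, Fin (n l i) => (p.1, (p.2 : ℕ))) (by
      rintro ⟨i, j⟩ ⟨i', j'⟩ h
      simp only [Prod.mk.injEq] at h
      obtain ⟨rfl, h⟩ := h
      rw [Fin.ext h])
  have hRm : ∀ l, Measurable fun ω p => R l p ω := fun l => by fun_prop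
  have hLLN : ∀ᵐ ω ∂Q, Tendsto
      (fun l => (∑ p, R l p ω ^ 2) / ((n l 0 + n l 1 : ℕ) : ℝ)) atTop (𝓝 κ) := by
    have h2 : ∀ i j, HasLaw (fun ω : Fin 2 × ℕ → ℝ => ω (i, j) ^ 2)
        ((ρ i).map fun s => s ^ 2) Q := fun i j =>
      HasLaw.comp (Y := fun s : ℝ => s ^ 2) ⟨by fun_prop, rfl⟩ (hQlaw (i, j))
    have h := tendsto_average_two_groups (Q := Q) (Y := fun i j ω => ω (i, j) ^ 2) hb hN
      (fun i => by
        have := (hint i 2 (by simp))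
        rw [← (hQlaw (i, 0)).map_eq, integrable_map_measure (by fun_prop)
          (hQlaw (i, 0)).aemeasurable] at this
        exact this)
      (fun i j k hjk => (hQindep.indepFun (i := (i, j)) (j := (i, k)) (by simpa using hjk)).comp
        (φ := fun s : ℝ => s ^ 2) (ψ := fun s : ℝ => s ^ 2) (by fun_prop) (by fun_prop))
      (fun i j => (h2 i j).identDistrib (h2 i 0))
    have hlim : ∑ i, b i * ∫ ω : Fin 2 × ℕ → ℝ, ω (i, 0) ^ 2 ∂Q = κ := by
      have h3 : ∀ i, ∫ ω : Fin 2 × ℕ → ℝ, ω (i, 0) ^ 2 ∂Q = γ i 2 * β ^ 2 := fun i => by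
        rw [← hmom i 2 (by simp), ← (hQlaw (i, 0)).map_eq,
          integral_map (hQlaw (i, 0)).aemeasurable (by fun_prop)]
      simp only [h3, Fin.sum_univ_two, hκ, meanSquare]
      ring
    rw [← hlim]
    exact h
  have hlin := tendstoInDistribution_linearizedRatio (P := fun _ => Q) hβ hint hmom hb hN hD.ne'
    hRlaw hRindep
  have hYm : ∀ l, Measurable
      fun ω => ((∑ p, R l p ω ^ 2) / ((n l 0 + n l 1 : ℕ) : ℝ))⁻¹ := fun l => by fun_prop
  have hY : TendstoInMeasure Q
      (fun l ω => ((∑ p, R l p ω ^ 2) / ((n l 0 + n l 1 : ℕ) : ℝ))⁻¹) atTop (fun _ => κ⁻¹) := by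
    refine tendstoInMeasure_of_tendsto_ae (fun l => (hYm l).aestronglyMeasurable) ?_
    filter_upwards [hLLN] with ω hω
    exact hω.inv₀ hκ0
  have hprod := hlin.continuous_comp_prodMk_of_tendstoInMeasure_const
    (g := fun x : EuclideanSpace ℝ (Fin 2 ⊕ Fin 2) × ℝ => x.2 • x.1) (by fun_prop) hY
    fun l => (hYm l).aemeasurable
  have hscaled : TendstoInDistribution (fun l ω => scaledRatio m fun p => R l p ω) atTop
      (fun x : EuclideanSpace ℝ (Fin 2 ⊕ Fin 2) => κ⁻¹ • κ • x) (fun _ => Q)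
      (multivariateGaussian 0 (asympCov b γ β)) := by
    -- The factorization of the ratio fails only where `∑ r² = 0`; almost surely this stops
    -- happening for large `l`, so the difference is eventually zero.
    refine tendstoInDistribution_of_tendstoInMeasure_sub _ _ hprod ?_
      fun l => ((measurable_scaledRatio m).comp (hRm l)).aemeasurable
    refine tendstoInMeasure_of_tendsto_ae (fun l => ?_) ?_
    · exact ((((measurable_scaledRatio m).comp (hRm l)).sub
        ((hYm l).smul ((measurable_linearizedRatio m).comp (hRm l))))).aestronglyMeasurable
    · filter_upwards [hLLN] with ω hω
      refine tendsto_const_nhds.congr' ?_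
      filter_upwards [hω.eventually_ne hκ0] with l hl
      have h0 : ∑ p, R l p ω ^ 2 ≠ 0 := fun h => hl (by rw [h, zero_div])
      simp only [Pi.sub_apply, Pi.zero_apply]
      rw [scaledRatio_eq m h0, sub_self]
  -- For each `l` both families of radii have the same product law, hence so do their images under
  -- `scaledRatio`.
  have hmap : ∀ l, (P l).map (fun ω => scaledRatio m fun p => r l p ω)
      = Q.map (fun ω => scaledRatio m fun p => R l p ω) := by
    intro l
    have h1 := AEMeasurable.map_map_of_aemeasurable
      (measurable_scaledRatio (n := n l) m).aemeasurable (hrm l)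
    have h2 := AEMeasurable.map_map_of_aemeasurable
      (measurable_scaledRatio (n := n l) m).aemeasurable (hRm l).aemeasurable (μ := Q)
    rw [map_eq_pi_of_hasLaw (hlaw l) (hindep l)] at h1
    rw [map_eq_pi_of_hasLaw (hRlaw l) (hRindep l)] at h2
    exact h1.symm.trans h2
  refine ⟨fun l => (measurable_scaledRatio m).comp_aemeasurable (hrm l), aemeasurable_id, ?_⟩
  have hfin := hscaled.tendsto
  simp only [inv_smul_smul₀ hκ0] at hfin
  refine Tendsto.congr (fun l => ?_) hfin
  exact Subtype.ext (hmap l).symm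

end Limit

/-! ### The feature vector of the random image -/

theorem lemma1
    -- compact primitives of unit area
    (A : Fin 2 → Set Plane) (hA : ∀ i, IsCompact (A i)) (hA1 : ∀ i, volume (A i) = 1)
    -- convex compact structuring elements for which `M` is invertible
    (B : Fin 2 → ConvexBody Plane) (hM : IsUnit (primitiveMatrix A B).det)
    -- the grain sizing distributions of the two primitives, and their moments
    (ρ : Fin 2 → Measure ℝ) [∀ i, IsProbabilityMeasure (ρ i)]
    (hρ0 : ∀ i, ∀ᵐ s ∂(ρ i), 0 ≤ s)
    (γ : Fin 2 → ℕ → ℝ) (β : ℝ) (hβ : 0 < β)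
    (hint : ∀ i, ∀ k ∈ Finset.Icc 2 8, Integrable (fun s : ℝ => s ^ k) (ρ i))
    (hmom : ∀ i, ∀ k ∈ Finset.Icc 2 8, ∫ s, s ^ k ∂(ρ i) = γ i k * β ^ k)
    -- the numbers of grains in the sequence of images: fixed proportions, `N → ∞`
    (b : Fin 2 → ℝ) (n : ℕ → Fin 2 → ℕ)
    (hb : ∀ l i, (n l i : ℝ) = b i * ((n l 0 + n l 1 : ℕ) : ℝ))
    (hN : Tendsto (fun l => n l 0 + n l 1) atTop atTop)
    (hpos : 0 < meanSquare b γ)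
    -- the images: independent radii, disjoint grains
    {Ω : ℕ → Type*} [∀ l, MeasurableSpace (Ω l)] (P : (l : ℕ) → Measure (Ω l))
    [∀ l, IsProbabilityMeasure (P l)]
    (r : (l : ℕ) → (Σ i, Fin (n l i)) → Ω l → ℝ)
    (hlaw : ∀ l p, HasLaw (r l p) (ρ p.1) (P l))
    (hindep : ∀ l, iIndepFun (r l) (P l))
    (c : (l : ℕ) → (Σ i, Fin (n l i)) → Ω l → Plane)
    (hdisj : ∀ l, ∀ᵐ ω ∂(P l), Pairwise fun p q =>
      Disjoint (grain A (fun p => r l p ω) (fun p => c l p ω) p)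
        (grain A (fun p => r l p ω) (fun p => c l p ω) q)) :
    (∀ l, ∀ᵐ ω ∂(P l),
      featureVector A B (grainImage A (fun p => r l p ω) (fun p => c l p ω)) =
        Sum.elim (fun i => radiiRatio (fun p => r l p ω) i 1)
          (fun i => radiiRatio (fun p => r l p ω) i 2)) ∧
    (asympCov b γ β).PosSemidef ∧
    TendstoInDistribution
      (fun l ω => WithLp.toLp 2
        (√((n l 0 + n l 1 : ℕ) : ℝ) •
          (featureVector A B (grainImage A (fun p => r l p ω) (fun p => c l p ω))
            - asympMean b γ β)))
      atTop (id : EuclideanSpace ℝ (Fin 2 ⊕ Fin 2) → EuclideanSpace ℝ (Fin 2 ⊕ Fin 2)) P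
      (multivariateGaussian 0 (asympCov b γ β)) := by
  have hfeature : ∀ l, ∀ᵐ ω ∂(P l),
      featureVector A B (grainImage A (fun p => r l p ω) (fun p => c l p ω)) =
        Sum.elim (fun i => radiiRatio (fun p => r l p ω) i 1)
          (fun i => radiiRatio (fun p => r l p ω) i 2) := by
    intro l
    have hr : ∀ᵐ ω ∂(P l), ∀ p, 0 ≤ r l p ω := ae_all_iff.2 fun p => by
      have h := hρ0 p.1
      rw [← (hlaw l p).map_eq] at h
      exact ae_of_ae_map (hlaw l p).aemeasurable h
    filter_upwards [hr, hdisj l] with ω hω hd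
    exact featureVector_grainImage hA hA1 hM hω hd
  refine ⟨hfeature, posSemidef_asympCov hint hmom hpos.ne' hβ.ne' (proportion_nonneg hb hN), ?_⟩
  refine (tendstoInDistribution_scaledRatio hβ.ne' hint hmom hb hN hpos hlaw hindep).congr
    (fun l => ?_) (ae_eq_refl _)
  filter_upwards [hfeature l] with ω hω
  rw [hω, scaledRatio]
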